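/- A node of a labelled rooted tree is a record if its label is the largest one on the path from the root to it; a node of a rooted forest (a vertex-disjoint set of rooted trees) is a record if it is a record in its own tree. For $n,k\ge 0$ let $R_\bullet(n,k)$ be the number of rooted trees with node set $\{1,\dots,n\}$ and exactly $k$ records, and let $R(n,k)$ be the number of rooted forests with node set $\{1,\dots,n\}$ and exactly $k$ records (so $R_\bullet(0,k)=0$ for all $k$, and $R(0,0)=1$ because of the empty forest). Put \[ \mathcal T(z)=\sum_{n\ge1} n^{n-1}\frac{z^n}{n!},\qquad \mathcal R_\bullet(z,t)=\sum_{n,k\ge0}R_\bullet(n,k)\frac{z^n}{n!}t^k,\qquad \mathcal R(z,t)=\sum_{n,k\ge0}R(n,k)\frac{z^n}{n!}t^k , \] where $\mathcal T\in\mathbb R[[z]]$ is the Cayley tree function and $\mathcal R_\bullet,\mathcal R$ are formal power series in $z$ with coefficients in $\mathbb R[t]$. Then: (a) for every integer $k\ge1$, in $\mathbb R[[z]]$, \[ [t^k]\,\mathcal R_\bullet(z,t)=\frac{\mathcal T(z)^k}{k}-\frac{\mathcal T(z)^{k+1}}{k+1}; \] (b) in $\mathbb R(t)[[z]]$, \[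 \mathcal R_\bullet(z,t)=\mathcal T(z)-\frac{t-1}{t}\,\log\bigl(1-t\,\mathcal T(z)\bigr); \] (c) in the field $\mathbb R(t)((z))$ of formal Laurent series, \[ \mathcal R(z,t)=\frac1z\,\mathcal T(z)\,\bigl(1-t\,\mathcal T(z)\bigr)^{-\frac{t-1}{t}} . \] Here, for a formal power series $f$ in $z$ with constant term $1$, $\log f=\sum_{m\ge1}\frac{(-1)^{m+1}}{m}(f-1)^m$ and $f^{\alpha}=\sum_{m\ge0}\binom{\alpha}{m}(f-1)^m$ for $\alpha\in\mathbb R(t)$. -/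

import Mathlib

open scoped Nat PowerSeries LaurentSeries Polynomial

noncomputable section

namespace RecordTrees

/-! ### Rooted labelled trees and forests, and their records -/

section Graphs

variable {V : Type*}

/-- For vertices of an acyclic graph `G` with linearly ordered labels: `v` is a record relative to
the root `r` if `v` carries the largest label on the path in `G` from `r` to `v`. As a path from
`r` to `v` is required to exist, `v` lies in the tree of `r`. -/
def IsRecord [LinearOrder V] (G : SimpleGraph V) (r v : V) : Prop :=
  ∃ p : G.Walk r v, p.IsPath ∧ ∀ w ∈ p.support, w ≤ v

/-- A rooted forest on `V`, given by its underlying graph `G` and its set `S` of roots: `G` is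
acyclic and each connected component of `G` (each tree of the forest) contains exactly one
root. -/
def IsRootedForest (G : SimpleGraph V) (S : Set V) : Prop :=
  G.IsAcyclic ∧ ∀ c : G.ConnectedComponent, ∃! r : V, r ∈ S ∧ G.connectedComponentMk r = c

/-- The records of the tree `G` rooted at `r`. -/
def treeRecords [LinearOrder V] (G : SimpleGraph V) (r : V) : Set V :=
  {v | IsRecord G r v}

/-- The records of the rooted forest `(G, S)`: the vertices that are records in their own tree. -/
def forestRecords [LinearOrder V] (G : SimpleGraph V) (S : Set V) : Set V :=
  {v | ∃ r ∈ S, IsRecord G r v}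

end Graphs

/-- The tree record number: the number of rooted labelled trees with `n` nodes and `k` records.
A rooted tree is a pair consisting of a tree on the label set `Fin n` and one of its vertices. -/
def treeRecordNumber (n k : ℕ) : ℕ :=
  {T : SimpleGraph (Fin n) × Fin n | T.1.IsTree ∧ (treeRecords T.1 T.2).ncard = k}.ncard

/-- The forest record number: the number of rooted labelled forests with `n` nodes and `k`
records. -/
def forestRecordNumber (n k : ℕ) : ℕ :=
  {F : SimpleGraph (Fin n) × Set (Fin n) |
    IsRootedForest F.1 F.2 ∧ (forestRecords F.1 F.2).ncard = k}.ncard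

lemma ncard_ne_of_lt {n k : ℕ} (h : n < k) (s : Set (Fin n)) : s.ncard ≠ k := by
  have h1 := Set.ncard_le_card s
  simp at h1
  omega

lemma treeRecordNumber_eq_zero {n k : ℕ} (h : n < k) : treeRecordNumber n k = 0 := by
  simp [treeRecordNumber, ncard_ne_of_lt h]

lemma forestRecordNumber_eq_zero {n k : ℕ} (h : n < k) : forestRecordNumber n k = 0 := by
  simp [forestRecordNumber, ncard_ne_of_lt h]

/-! ### Generating functions -/

/-- The Cayley tree function `T(z) = ∑_{n ≥ 1} n ^ (n - 1) z ^ n / n!`, as a formal power series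
with coefficients in a `ℚ`-algebra `A`. -/
def cayleyTree (A : Type*) [CommRing A] [Algebra ℚ A] : A⟦X⟧ :=
  PowerSeries.mk fun n => if n = 0 then 0 else algebraMap ℚ A ((n : ℚ) ^ (n - 1) / n !)

/-- The generating function `∑_{n, k ≥ 0} a n k (z ^ n / n!) t ^ k` of a triangular array `a`
(one with `a n k = 0` for `k > n`), as a power series in `z` with coefficients in `ℝ[t]`. -/
def arraySeries (a : ℕ → ℕ → ℕ) : ℝ[X]⟦X⟧ :=
  PowerSeries.mk fun n =>
    ∑ k ∈ Finset.range (n + 1), Polynomial.C ((a n k : ℝ) / n !) * Polynomial.X ^ k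

/-- The tree record function `∑_{n, k ≥ 0} R•(n, k) (z ^ n / n!) t ^ k`. -/
def treeRecordSeries : ℝ[X]⟦X⟧ := arraySeries treeRecordNumber

/-- The forest record function `∑_{n, k ≥ 0} R(n, k) (z ^ n / n!) t ^ k`. -/
def forestRecordSeries : ℝ[X]⟦X⟧ := arraySeries forestRecordNumber

/-- The coefficient `[t ^ k] F` of `F ∈ ℝ[t]⟦z⟧`, a power series in `z`. -/
def coeffT (k : ℕ) (F : ℝ[X]⟦X⟧) : ℝ⟦X⟧ :=
  PowerSeries.mk fun n => (PowerSeries.coeff n F).coeff k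

lemma coeff_coeffT_arraySeries {a : ℕ → ℕ → ℕ} (ha : ∀ n k, n < k → a n k = 0) (n k : ℕ) :
    PowerSeries.coeff n (coeffT k (arraySeries a)) = (a n k : ℝ) / n ! := by
  have h : ¬ k < n + 1 → a n k = 0 := fun h => ha n k (by omega)
  simp +contextual [coeffT, arraySeries, Polynomial.coeff_C_mul,
    Polynomial.coeff_X_pow, h]

/-- No terms are lost in the definition of the tree record function. -/
lemma coeff_treeRecordSeries (n k : ℕ) :
    PowerSeries.coeff n (coeffT k treeRecordSeries) = (treeRecordNumber n k : ℝ) / n ! :=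
  coeff_coeffT_arraySeries (fun _ _ => treeRecordNumber_eq_zero) n k

/-- No terms are lost in the definition of the forest record function. -/
lemma coeff_forestRecordSeries (n k : ℕ) :
    PowerSeries.coeff n (coeffT k forestRecordSeries) = (forestRecordNumber n k : ℝ) / n ! :=
  coeff_coeffT_arraySeries (fun _ _ => forestRecordNumber_eq_zero) n k

/-- The inclusion of `ℝ[t]⟦z⟧` into `ℝ(t)⟦z⟧`, where division by `t` is possible. -/
def toRatFunc : ℝ[X]⟦X⟧ →+* (RatFunc ℝ)⟦X⟧ :=
  PowerSeries.map (algebraMap ℝ[X] (RatFunc ℝ))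

/-- The power `f ^ α = ∑_m (α choose m) (f - 1) ^ m` of a power series `f` with constant
coefficient `1`, for an exponent `α` in the coefficient ring. -/
def powOf {A : Type*} [CommRing A] [BinomialRing A] (f : A⟦X⟧) (α : A) : A⟦X⟧ :=
  (PowerSeries.binomialSeries A α).subst (f - 1)

end RecordTrees

end

/-! Remove the largest node `m` of a forest together with its set `D` of proper descendants. The
node `m` is always a record, no node of `D` is one because `m` lies above it, and on the remaining
set `A` ancestors and records do not change. Conversely, `m` may be a root or a child of any node of
`A`, and the forest on `D` is arbitrary. This is `forestSum_insert`, where a weight `ψ` on the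
number of roots treats forests (`ψ = 1`) and trees (`ψ r = 1` exactly for `r = 1`) together.

Let F = ∑ (n+1)^(n-1) z^n/n!, so that T = zF. The recursion becomes S' = t(zS' + U)F, with U = S for
forests and U = 1 for trees, since `m` is the root of a tree exactly when nothing remains. Hence (1
- tT)S' = tFU. That F counts all forests is the case t = 1, which amounts to F' = T'F, a form of
Abel's identity. Combined with T = zF this gives T'(1 - T) = F.

For trees, dR•/dT = t(1 - T)/(1 - tT). Integration gives (b), and the coefficient T^(k-1)(1 - T) of
t^k integrates to (a). For forests R' = R R•', which F(1 - tT)^(-(t-1)/t) satisfies, and F = T/z.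
All these equations are checked in division-free form.

Graph-theoretic forests are counted through parent maps: `parentGraph_injOn` and
`IsRootedForest.exists_parentMap` make the two encodings equivalent. -/

namespace RecordTrees

/-! ### Parent maps -/

section ParentMaps

variable {V : Type*}

/-- `Anc p v w`: the node `w` is obtained from `v` by iterating the parent map `p`. -/
def Anc (p : V → Option V) : V → V → Prop :=
  Relation.ReflTransGen fun a b => p a = some b

/-- A rooted forest on the node set `A`, encoded by its parent map. -/
def IsParentMap (A : Finset V) (p : V → Option V) : Prop :=
  (∀ v w, p v = some w → v ∈ A ∧ w ∈ A) ∧ WellFounded fun b a => p a = some b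

/-- A cycle through `v` also passes through the parent of `v`, so well-founded induction pushes it
towards the root forever. -/
lemma IsParentMap.not_anc {A : Finset V} {p : V → Option V} (hp : IsParentMap A p) :
    ∀ v w, p v = some w → ¬ Anc p w v := by
  intro v
  induction v using hp.2.induction with
  | _ v ih =>
    intro w hw h
    rcases Relation.ReflTransGen.cases_head h with rfl | ⟨u, hu, h'⟩
    · exact ih w hw w hw .refl
    · exact ih w hw u hu (h'.tail hw)

/-- An ancestor chain that starts in a set closed under parents never leaves it, so only the values
on that set matter. This carries ancestors between a forest and its graft. -/
lemma Anc.of_agree {A : Finset V} {p p' : V → Option V}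
    (hcl : ∀ v ∈ A, ∀ w, p v = some w → w ∈ A) (h : ∀ v ∈ A, p' v = p v) {v w : V}
    (hv : v ∈ A) (ha : Anc p v w) : w ∈ A ∧ Anc p' v w := by
  induction ha with
  | refl => exact ⟨hv, .refl⟩
  | @tail b c _ hbc ih => exact ⟨hcl b ih.1 c hbc, ih.2.tail ((h b ih.1).trans hbc)⟩

open scoped Classical in
/-- The parent maps of the rooted forests on the node set `A`. -/
noncomputable def parentMaps [Fintype V] (A : Finset V) : Finset (V → Option V) :=
  {p | IsParentMap A p}

@[simp]
lemma mem_parentMaps [Fintype V] {A : Finset V} {p : V → Option V} :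
    p ∈ parentMaps A ↔ IsParentMap A p := by simp [parentMaps]

open scoped Classical in
/-- The roots of a forest given by its parent map. -/
noncomputable def rootSet (A : Finset V) (p : V → Option V) : Finset V := {v ∈ A | p v = none}

open scoped Classical in
/-- The records of a forest given by its parent map. -/
noncomputable def recordSet [LinearOrder V] (A : Finset V) (p : V → Option V) : Finset V :=
  {v ∈ A | ∀ w, Anc p v w → w ≤ v}

/-- Every node of a forest has a root as an ancestor. -/
lemma exists_anc_root {p : V → Option V} (hp : WellFounded fun b a => p a = some b) (v : V) :
    ∃ r, Anc p v r ∧ p r = none := by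
  induction v using hp.induction with
  | _ v ih =>
    rcases h : p v with _ | w
    · exact ⟨v, .refl, h⟩
    · obtain ⟨r, hr, hr'⟩ := ih w h
      exact ⟨r, hr.head h, hr'⟩

lemma IsParentMap.anc_mem {A : Finset V} {p : V → Option V} (hp : IsParentMap A p) {v w : V}
    (hv : v ∈ A) (h : Anc p v w) : w ∈ A :=
  (h.of_agree (p' := p) (fun a _ b hab => (hp.1 a b hab).2) (fun _ _ => rfl) hv).1

lemma rootSet_nonempty {A : Finset V} {p : V → Option V} (hp : IsParentMap A p)
    (hA : A.Nonempty) : (rootSet A p).Nonempty := by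
  obtain ⟨v, hv⟩ := hA
  obtain ⟨r, hr, hr'⟩ := exists_anc_root hp.2 v
  exact ⟨r, by simp [rootSet, hr', hp.anc_mem hv hr]⟩

lemma isParentMap_empty {p : V → Option V} : IsParentMap ∅ p ↔ p = fun _ => none := by
  constructor
  · intro h
    funext v
    rcases hv : p v with _ | w
    · rfl
    · simpa using (h.1 v w hv).1
  · rintro rfl
    exact ⟨by simp, ⟨fun a => ⟨_, by simp⟩⟩⟩

/-! #### Grafting a forest below a new node -/

section Graft

variable [DecidableEq V]

/-- The forest obtained from a forest `p₁` by adding a node `m` with parent `q`, and making the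
roots of a forest `p₂` on `D` children of `m`. -/
def graft (m : V) (D : Finset V) (p₁ p₂ : V → Option V) (q : Option V) : V → Option V :=
  fun v => if v = m then q else if v ∈ D then some ((p₂ v).getD m) else p₁ v

variable {m : V} {A D : Finset V} {p₁ p₂ : V → Option V} {q : Option V}

@[simp]
lemma graft_self : graft m D p₁ p₂ q m = q := by simp [graft]

lemma graft_of_mem (hm : m ∉ D) {v : V} (hv : v ∈ D) :
    graft m D p₁ p₂ q v = some ((p₂ v).getD m) := by
  have : v ≠ m := fun h => hm (h ▸ hv)
  simp [graft, this, hv]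

lemma graft_of_mem_left (hm : m ∉ A) (hAD : Disjoint A D) {v : V} (hv : v ∈ A) :
    graft m D p₁ p₂ q v = p₁ v := by
  have h1 : v ≠ m := fun h => hm (h ▸ hv)
  have h2 : v ∉ D := Finset.disjoint_left.1 hAD hv
  simp [graft, h1, h2]

lemma graft_closed (hmA : m ∉ A) (hAD : Disjoint A D) (h₁ : IsParentMap A p₁) :
    ∀ v ∈ A, ∀ w, graft m D p₁ p₂ q v = some w → w ∈ A := by
  intro v hv w h
  rw [graft_of_mem_left hmA hAD hv] at h
  exact (h₁.1 v w h).2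

/-- Accessibility is obtained in the order `A`, `m`, `D`: parents of nodes of `A` stay in `A`, the
parent of `m` lies in `A`, and chains from `D` run inside `D` until they reach `m`. -/
lemma isParentMap_graft (hmA : m ∉ A) (hmD : m ∉ D) (hAD : Disjoint A D)
    (h₁ : IsParentMap A p₁) (h₂ : IsParentMap D p₂) (hq : ∀ w, q = some w → w ∈ A) :
    IsParentMap (insert m (A ∪ D)) (graft m D p₁ p₂ q) := by
  have hA : ∀ v, v ∈ A → Acc (fun b a => graft m D p₁ p₂ q a = some b) v := by
    intro v
    induction v using h₁.2.induction with
    | _ v ih =>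
      intro hv
      refine ⟨_, fun w hw => ih w ?_ (graft_closed hmA hAD h₁ v hv w hw)⟩
      rwa [graft_of_mem_left hmA hAD hv] at hw
  have hm : Acc (fun b a => graft m D p₁ p₂ q a = some b) m :=
    ⟨_, fun w hw => hA w (hq w (by simpa using hw))⟩
  have hD : ∀ v, v ∈ D → Acc (fun b a => graft m D p₁ p₂ q a = some b) v := by
    intro v
    induction v using h₂.2.induction with
    | _ v ih =>
      intro hv
      refine ⟨_, fun w hw => ?_⟩
      rw [graft_of_mem hmD hv] at hw
      rcases h : p₂ v with _ | u
      · simp only [h, Option.getD_none, Option.some.injEq] at hw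
        exact hw ▸ hm
      · simp only [h, Option.getD_some, Option.some.injEq] at hw
        subst hw
        exact ih u h (h₂.1 v u h).2
  have hout : ∀ v w, v ∉ insert m (A ∪ D) → graft m D p₁ p₂ q v ≠ some w := by
    intro v w hv h
    simp only [Finset.mem_insert, Finset.mem_union, not_or] at hv
    simp only [graft, hv.1, hv.2.2, if_false] at h
    exact hv.2.1 (h₁.1 v w h).1
  refine ⟨fun v w h => ?_, ⟨fun v => ?_⟩⟩
  · have hv : v ∈ insert m (A ∪ D) := by
      by_contra hv
      exact hout v w hv h
    refine ⟨hv, ?_⟩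
    simp only [Finset.mem_insert, Finset.mem_union] at hv ⊢
    rcases hv with rfl | hv | hv
    · exact .inr (.inl (hq w (by simpa using h)))
    · exact .inr (.inl (graft_closed hmA hAD h₁ v hv w h))
    · rw [graft_of_mem hmD hv] at h
      rcases h' : p₂ v with _ | u
      · simp only [h', Option.getD_none, Option.some.injEq] at h
        exact .inl h.symm
      · simp only [h', Option.getD_some, Option.some.injEq] at h
        exact .inr (.inr (h ▸ (h₂.1 v u h').2))
  · by_cases hv : v ∈ insert m (A ∪ D)
    · simp only [Finset.mem_insert, Finset.mem_union] at hv
      rcases hv with rfl | hv | hv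
      exacts [hm, hA v hv, hD v hv]
    · exact ⟨_, fun w hw => (hout v w hv hw).elim⟩

lemma anc_graft_of_mem (hmD : m ∉ D) (h₂ : IsParentMap D p₂) :
    ∀ v ∈ D, Anc (graft m D p₁ p₂ q) v m := by
  intro v
  induction v using h₂.2.induction with
  | _ v ih =>
    intro hv
    have h := graft_of_mem (p₁ := p₁) (p₂ := p₂) (q := q) hmD hv
    rcases h' : p₂ v with _ | u
    · rw [h'] at h
      exact .single h
    · rw [h'] at h
      exact (ih u h' (h₂.1 v u h').2).head h

lemma not_anc_graft (hmA : m ∉ A) (hAD : Disjoint A D) (h₁ : IsParentMap A p₁) {v : V}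
    (hv : v ∈ A) : ¬ Anc (graft m D p₁ p₂ q) v m := fun h =>
  hmA (h.of_agree (p' := p₁) (graft_closed hmA hAD h₁)
    (fun _ ha => (graft_of_mem_left hmA hAD ha).symm) hv).1

/-- Every node of `D` acquires a parent, so `m` is the only possible new root. -/
lemma card_rootSet_graft (hmA : m ∉ A) (hmD : m ∉ D) (hAD : Disjoint A D) :
    (rootSet (insert m (A ∪ D)) (graft m D p₁ p₂ q)).card =
      (rootSet A p₁).card + if q = none then 1 else 0 := by
  classical
  have h : rootSet (A ∪ D) (graft m D p₁ p₂ q) = rootSet A p₁ := by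
    ext v
    simp only [rootSet, Finset.mem_filter, Finset.mem_union]
    constructor
    · rintro ⟨hv | hv, h⟩
      · exact ⟨hv, by rwa [graft_of_mem_left hmA hAD hv] at h⟩
      · simp [graft_of_mem hmD hv] at h
    · rintro ⟨hv, h⟩
      exact ⟨.inl hv, by rwa [graft_of_mem_left hmA hAD hv]⟩
  have hm : m ∉ rootSet A p₁ := fun h => hmA (by simp [rootSet] at h; exact h.1)
  unfold rootSet at h hm ⊢
  rw [Finset.filter_insert, graft_self, h]
  split_ifs <;> simp [hm]

end Graft

/-- The label `m` exceeds all others and `m` is an ancestor of all of `D`: it becomes a record and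
destroys those of `p₂`, while nodes of `A` keep their ancestors. -/
lemma card_recordSet_graft [LinearOrder V] {m : V} {A D : Finset V} {p₁ p₂ : V → Option V}
    {q : Option V} (hmA : ∀ a ∈ A, a < m) (hmD : ∀ a ∈ D, a < m) (hAD : Disjoint A D)
    (h₁ : IsParentMap A p₁) (h₂ : IsParentMap D p₂) (hq : ∀ w, q = some w → w ∈ A) :
    (recordSet (insert m (A ∪ D)) (graft m D p₁ p₂ q)).card = (recordSet A p₁).card + 1 := by
  classical
  have hmA' : m ∉ A := fun h => lt_irrefl _ (hmA m h)
  have hmD' : m ∉ D := fun h => lt_irrefl _ (hmD m h)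
  have hp := isParentMap_graft hmA' hmD' hAD h₁ h₂ hq
  have h : recordSet (insert m (A ∪ D)) (graft m D p₁ p₂ q) = insert m (recordSet A p₁) := by
    ext v
    simp only [recordSet, Finset.mem_filter, Finset.mem_insert, Finset.mem_union]
    constructor
    · rintro ⟨rfl | hv | hv, h⟩
      · exact .inl rfl
      · refine .inr ⟨hv, fun w hw => h w ?_⟩
        exact (hw.of_agree (fun a _ b hab => (h₁.1 a b hab).2)
          (fun a ha => graft_of_mem_left hmA' hAD ha) hv).2
      · exact ((h m (anc_graft_of_mem hmD' h₂ v hv)).not_gt (hmD v hv)).elim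
    · rintro (rfl | ⟨hv, h⟩)
      · refine ⟨.inl rfl, fun w hw => ?_⟩
        have := hp.anc_mem (Finset.mem_insert_self _ _) hw
        simp only [Finset.mem_insert, Finset.mem_union] at this
        rcases this with rfl | hw | hw
        exacts [le_rfl, (hmA w hw).le, (hmD w hw).le]
      · refine ⟨.inr (.inl hv), fun w hw => h w ?_⟩
        exact (hw.of_agree (graft_closed hmA' hAD h₁)
          (fun a ha => (graft_of_mem_left hmA' hAD ha).symm) hv).2
  rw [h, Finset.card_insert_of_notMem]
  simp [recordSet, hmA']

/-! #### Cutting a forest at a node -/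

section Cut

variable [DecidableEq V] {m : V} {A D : Finset V} {p : V → Option V}

/-- The restriction of a forest to the nodes in `A`. -/
def cutUpper (A : Finset V) (p : V → Option V) : V → Option V :=
  fun v => if v ∈ A then p v else none

/-- The forest of proper descendants of `m`, if these form the set `D`. -/
def cutLower (m : V) (D : Finset V) (p : V → Option V) : V → Option V :=
  fun v => if v ∈ D then (if p v = some m then none else p v) else none

lemma cutLower_eq_some {v w : V} :
    cutLower m D p v = some w ↔ v ∈ D ∧ p v = some w ∧ w ≠ m := by
  simp only [cutLower]
  split_ifs with h1 h2
  · simp only [h1, h2, true_and, Option.some.injEq, false_iff, not_and, not_not]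
    exact fun h => h.symm
  · simp only [h1, true_and]
    exact ⟨fun h => ⟨h, fun h' => h2 (h' ▸ h)⟩, fun h => h.1⟩
  · simp [h1]

lemma cutUpper_eq_some {v w : V} : cutUpper A p v = some w ↔ v ∈ A ∧ p v = some w := by
  simp only [cutUpper]
  split_ifs with h1 <;> simp [h1]

lemma isParentMap_cutUpper (hp : IsParentMap (insert m (A ∪ D)) p)
    (hA : ∀ v ∈ A, ¬ Anc p v m) (hD : ∀ v ∈ D, Anc p v m) : IsParentMap A (cutUpper A p) := by
  refine ⟨fun v w h => ?_, Subrelation.wf (fun h => (cutUpper_eq_some.1 h).2) hp.2⟩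
  obtain ⟨hv, h⟩ := cutUpper_eq_some.1 h
  refine ⟨hv, ?_⟩
  have := (hp.1 v w h).2
  simp only [Finset.mem_insert, Finset.mem_union] at this
  rcases this with rfl | hw | hw
  · exact (hA v hv (.single h)).elim
  · exact hw
  · exact (hA v hv ((hD w hw).head h)).elim

lemma mem_of_anc (hp : IsParentMap (insert m (A ∪ D)) p)
    (hA : ∀ v ∈ A, ¬ Anc p v m) (hD : ∀ v ∈ D, Anc p v m) (hmD : m ∉ D) {v w : V} (hv : v ∈ D)
    (h : p v = some w) (hw : w ≠ m) : w ∈ D := by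
  have hw' := (hp.1 v w h).2
  simp only [Finset.mem_insert, Finset.mem_union, hw, false_or] at hw'
  refine hw'.resolve_left fun hwA => hA w hwA ?_
  rcases Relation.ReflTransGen.cases_head (hD v hv) with rfl | ⟨u, hu, h'⟩
  · exact (hmD hv).elim
  · obtain rfl : w = u := by simpa [h] using hu
    exact h'

lemma isParentMap_cutLower (hp : IsParentMap (insert m (A ∪ D)) p)
    (hA : ∀ v ∈ A, ¬ Anc p v m) (hD : ∀ v ∈ D, Anc p v m) (hmD : m ∉ D) :
    IsParentMap D (cutLower m D p) := by
  refine ⟨fun v w h => ?_, Subrelation.wf (fun h => (cutLower_eq_some.1 h).2.1) hp.2⟩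
  obtain ⟨hv, h, hw⟩ := cutLower_eq_some.1 h
  exact ⟨hv, mem_of_anc hp hA hD hmD hv h hw⟩

/-- A parent of `m` equal to `m` or descending from it would close a cycle. -/
lemma mem_of_parent_eq (hp : IsParentMap (insert m (A ∪ D)) p)
    (hD : ∀ v ∈ D, Anc p v m) {w : V} (h : p m = some w) : w ∈ A := by
  have hw := (hp.1 m w h).2
  simp only [Finset.mem_insert, Finset.mem_union] at hw
  rcases hw with rfl | hw | hw
  · exact (hp.not_anc w w h .refl).elim
  · exact hw
  · exact (hp.not_anc m w h (hD w hw)).elim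

lemma graft_cut (hp : IsParentMap (insert m (A ∪ D)) p) (hD : ∀ v ∈ D, Anc p v m)
    (hmD : m ∉ D) :
    graft m D (cutUpper A p) (cutLower m D p) (p m) = p := by
  funext v
  simp only [graft]
  split_ifs with h1 h2
  · rw [h1]
  · rcases h : p v with _ | w
    · rcases Relation.ReflTransGen.cases_head (hD v h2) with rfl | ⟨u, hu, -⟩
      · exact (hmD h2).elim
      · simp [h] at hu
    · by_cases hw : w = m
      · simp [cutLower, h2, h, hw]
      · simp [cutLower, h2, h, hw]
  · simp only [cutUpper]
    split_ifs with h3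
    · rfl
    · rcases h : p v with _ | w
      · rfl
      · have := (hp.1 v w h).1
        simp [h1, h2, h3] at this

lemma cutUpper_graft {p₁ p₂ : V → Option V} {q : Option V} (hmA : m ∉ A) (hAD : Disjoint A D)
    (h₁ : IsParentMap A p₁) : cutUpper A (graft m D p₁ p₂ q) = p₁ := by
  funext v
  simp only [cutUpper]
  split_ifs with h
  · exact graft_of_mem_left hmA hAD h
  · rcases h' : p₁ v with _ | w
    · rfl
    · exact (h (h₁.1 v w h').1).elim

lemma cutLower_graft {p₁ p₂ : V → Option V} {q : Option V} (hmD : m ∉ D)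
    (h₂ : IsParentMap D p₂) : cutLower m D (graft m D p₁ p₂ q) = p₂ := by
  funext v
  simp only [cutLower]
  rcases h' : p₂ v with _ | w
  · split_ifs with h h3
    · rfl
    · simp [graft_of_mem hmD h, h'] at h3
    · rfl
  · have hv := h₂.1 v w h'
    have : w ≠ m := fun h => hmD (h ▸ hv.2)
    simp [graft_of_mem hmD hv.1, h', hv.1, this]

end Cut

/-! #### The recursion -/

section Recursion

variable [Fintype V] [LinearOrder V] {R : Type*} [CommRing R]

/-- The sum of `x ^ (number of records) * ψ (number of roots)` over the forests on `A`. -/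
noncomputable def forestSum (x : R) (ψ : ℕ → R) (A : Finset V) : R :=
  ∑ p ∈ parentMaps A, x ^ (recordSet A p).card * ψ (rootSet A p).card

lemma forestSum_empty (x : R) (ψ : ℕ → R) : forestSum x ψ (∅ : Finset V) = ψ 0 := by
  have : parentMaps (∅ : Finset V) = {fun _ => none} := by
    ext p
    simp [isParentMap_empty]
  simp [forestSum, this, recordSet, rootSet]

lemma forestSum_root_eq_zero (x : R) (A : Finset V) :
    forestSum x (fun r => if r = 0 then 1 else 0) A = if A = ∅ then 1 else 0 := by
  rcases A.eq_empty_or_nonempty with rfl | hA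
  · simp [forestSum_empty]
  · rw [if_neg hA.ne_empty]
    refine Finset.sum_eq_zero fun p hp => ?_
    have := rootSet_nonempty (mem_parentMaps.1 hp) hA
    simp [this.ne_empty]

/-- Grafting and cutting are inverse bijections between triples `(p₁, p₂, q)` and forests in which
`D` is exactly the set of proper descendants of `m`. The `A.card` choices of a parent keep the
number of roots and `q = none` raises it by one; `p₂` contributes neither records nor roots, hence
its weight 1. -/
lemma forestSum_filter (x : R) (ψ : ℕ → R) {m : V} {A D : Finset V} (hmA : ∀ a ∈ A, a < m)
    (hmD : ∀ a ∈ D, a < m) (hAD : Disjoint A D) [DecidablePred fun p : V → Option V =>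
      (∀ v ∈ A, ¬ Anc p v m) ∧ ∀ v ∈ D, Anc p v m] :
    ∑ p ∈ parentMaps (insert m (A ∪ D)) with (∀ v ∈ A, ¬ Anc p v m) ∧ ∀ v ∈ D, Anc p v m,
        x ^ (recordSet (insert m (A ∪ D)) p).card * ψ (rootSet (insert m (A ∪ D)) p).card =
      x * ((A.card * forestSum x ψ A + forestSum x (fun r => ψ (r + 1)) A) *
        forestSum 1 (fun _ => 1) D) := by
  have hmA' : m ∉ A := fun h => lt_irrefl _ (hmA m h)
  have hmD' : m ∉ D := fun h => lt_irrefl _ (hmD m h)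
  have hq : ∀ q ∈ Finset.insertNone A, ∀ w, q = some w → w ∈ A := by
    rintro q hq w rfl
    simpa using hq
  calc _ = ∑ u ∈ (parentMaps A ×ˢ parentMaps D) ×ˢ Finset.insertNone A,
        x ^ ((recordSet A u.1.1).card + 1) *
          ψ ((rootSet A u.1.1).card + if u.2 = none then 1 else 0) := by
        symm
        refine Finset.sum_nbij' (fun u => graft m D u.1.1 u.1.2 u.2)
          (fun p => ((cutUpper A p, cutLower m D p), p m)) ?_ ?_ ?_ ?_ ?_
        · rintro ⟨⟨p₁, p₂⟩, q⟩ hu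
          simp only [Finset.mem_product, mem_parentMaps] at hu
          obtain ⟨⟨h₁, h₂⟩, hq'⟩ := hu
          simp only [Finset.mem_filter, mem_parentMaps]
          exact ⟨isParentMap_graft hmA' hmD' hAD h₁ h₂ (hq q hq'),
            fun v hv => not_anc_graft hmA' hAD h₁ hv, anc_graft_of_mem hmD' h₂⟩
        · intro p hp
          simp only [Finset.mem_filter, mem_parentMaps] at hp
          obtain ⟨hp, hA, hD⟩ := hp
          simp only [Finset.mem_product, mem_parentMaps]
          refine ⟨⟨isParentMap_cutUpper hp hA hD, isParentMap_cutLower hp hA hD hmD'⟩, ?_⟩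
          rcases h : p m with _ | w
          · simp
          · simpa using mem_of_parent_eq hp hD h
        · rintro ⟨⟨p₁, p₂⟩, q⟩ hu
          simp only [Finset.mem_product, mem_parentMaps] at hu
          obtain ⟨⟨h₁, h₂⟩, hq'⟩ := hu
          simp [cutUpper_graft hmA' hAD h₁, cutLower_graft hmD' h₂]
        · intro p hp
          simp only [Finset.mem_filter, mem_parentMaps] at hp
          exact graft_cut hp.1 hp.2.2 hmD'
        · rintro ⟨⟨p₁, p₂⟩, q⟩ hu
          simp only [Finset.mem_product, mem_parentMaps] at hu
          obtain ⟨⟨h₁, h₂⟩, hq'⟩ := hu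
          simp only
          rw [card_recordSet_graft hmA hmD hAD h₁ h₂ (hq q hq'),
            card_rootSet_graft hmA' hmD' hAD]
    _ = _ := by
        rw [Finset.sum_product, Finset.sum_product]
        simp only [Finset.sum_insertNone, if_true, reduceCtorEq, if_false, Finset.sum_const,
          forestSum, one_pow, nsmul_eq_mul, add_zero, mul_one, Finset.mul_sum,
          ← Finset.sum_add_distrib, Finset.sum_mul]
        refine Finset.sum_congr rfl fun p _ => ?_
        ring

/-- Removing the largest node of a forest, together with its descendants. -/
lemma forestSum_insert (x : R) (ψ : ℕ → R) {m : V} {A : Finset V} (hm : ∀ a ∈ A, a < m) :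
    forestSum x ψ (insert m A) = x * ∑ D ∈ A.powerset,
      (((A \ D).card * forestSum x ψ (A \ D) + forestSum x (fun r => ψ (r + 1)) (A \ D)) *
        forestSum 1 (fun _ => 1) D) := by
  classical
  rw [forestSum, ← Finset.sum_fiberwise_of_maps_to (t := A.powerset)
    (g := fun p => {v ∈ A | Anc p v m}) (fun p _ => by simp), Finset.mul_sum]
  refine Finset.sum_congr rfl fun D hD => ?_
  rw [Finset.mem_powerset] at hD
  rw [← forestSum_filter x ψ (fun a ha => hm a (Finset.mem_sdiff.1 ha).1)
    (fun a ha => hm a (hD ha)) Finset.sdiff_disjoint, Finset.sdiff_union_of_subset hD]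
  refine Finset.sum_congr ?_ fun _ _ => rfl
  ext p
  simp only [Finset.mem_filter, and_congr_right_iff, Finset.ext_iff, Finset.mem_sdiff]
  intro _
  constructor
  · intro h
    exact ⟨fun v hv hv' => hv.2 ((h v).1 ⟨hv.1, hv'⟩), fun v hv => ((h v).2 hv).2⟩
  · rintro ⟨h1, h2⟩ v
    refine ⟨fun hv => ?_, fun hv => ⟨hD hv, h2 v hv⟩⟩
    by_contra hvD
    exact h1 v ⟨hv.1, hvD⟩ hv.2

end Recursion

end ParentMaps

/-! ### Rooted forests as graphs and as parent maps -/

section ParentGraph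

variable {V : Type*}

/-- The graph of a forest given by its parent map. -/
def parentGraph (p : V → Option V) : SimpleGraph V :=
  SimpleGraph.fromRel fun a b => p a = some b

lemma parentGraph_adj {p : V → Option V} (hp : WellFounded fun b a => p a = some b) {a b : V} :
    (parentGraph p).Adj a b ↔ p a = some b ∨ p b = some a := by
  simp only [parentGraph, SimpleGraph.fromRel_adj, and_iff_right_iff_imp]
  rintro h rfl
  exact hp.irrefl.irrefl a (by simpa using h)

/-- The descendants of a root form a union of components. -/
lemma anc_of_reachable {p : V → Option V} (hp : WellFounded fun b a => p a = some b) {r v w : V}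
    (hr : p r = none) (h : (parentGraph p).Reachable v w) (hv : Anc p v r) : Anc p w r := by
  obtain ⟨q⟩ := h
  induction q with
  | nil => exact hv
  | @cons a b c hab _ ih =>
    apply ih
    rcases (parentGraph_adj hp).1 hab with h | h
    · rcases Relation.ReflTransGen.cases_head hv with rfl | ⟨u, hu, h'⟩
      · simp [hr] at h
      · obtain rfl : b = u := by simpa [h] using hu
        exact h'
    · exact hv.head h

lemma reachable_of_anc {p : V → Option V} (hp : WellFounded fun b a => p a = some b) {v w : V}
    (h : Anc p v w) : (parentGraph p).Reachable v w := by
  induction h with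
  | refl => rfl
  | tail _ hbc ih => exact ih.trans ((parentGraph_adj hp).2 (.inl hbc)).reachable

/-- Each edge from `a` to its parent `b` is a bridge: once it is deleted, the descendants of `a` are
closed under adjacency, and `b` is not one of them. -/
lemma isAcyclic_parentGraph {A : Finset V} {p : V → Option V} (hp : IsParentMap A p) :
    (parentGraph p).IsAcyclic := by
  have key : ∀ a b, p a = some b → (parentGraph p).IsBridge s(a, b) := by
    intro a b hab
    rw [SimpleGraph.isBridge_iff]
    have : ∀ x y, ((parentGraph p).deleteEdges {s(a, b)}).Walk x y → Anc p x a → Anc p y a := by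
      intro x y q
      induction q with
      | nil => exact id
      | @cons x y z hxy _ ih =>
        intro hx
        apply ih
        rw [SimpleGraph.deleteEdges_adj] at hxy
        rcases (parentGraph_adj hp.2).1 hxy.1 with h | h
        · rcases Relation.ReflTransGen.cases_head hx with rfl | ⟨u, hu, h'⟩
          · obtain rfl : b = y := by simpa [hab] using h
            exact (hxy.2 rfl).elim
          · obtain rfl : y = u := by simpa [h] using hu
            exact h'
        · exact hx.head h
    rintro ⟨q⟩
    exact hp.not_anc a b hab (this a b q .refl)
  rw [SimpleGraph.isAcyclic_iff_forall_adj_isBridge]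
  intro a b hab
  rcases (parentGraph_adj hp.2).1 hab with h | h
  · exact key a b h
  · rw [Sym2.eq_swap]
    exact key b a h

lemma isRootedForest_parentGraph {A : Finset V} {p : V → Option V} (hp : IsParentMap A p) :
    IsRootedForest (parentGraph p) {v | p v = none} := by
  refine ⟨isAcyclic_parentGraph hp, fun c => ?_⟩
  induction c using SimpleGraph.ConnectedComponent.ind with
  | _ v =>
  obtain ⟨r, hr, hr'⟩ := exists_anc_root hp.2 v
  refine ⟨r, ⟨hr', SimpleGraph.ConnectedComponent.eq.2 (reachable_of_anc hp.2 hr).symm⟩, ?_⟩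
  rintro s ⟨hs, hs'⟩
  have h := anc_of_reachable hp.2 hr' (SimpleGraph.ConnectedComponent.eq.1 hs').symm hr
  rcases Relation.ReflTransGen.cases_head h with rfl | ⟨u, hu, -⟩
  · rfl
  · rw [Set.mem_ofPred_eq] at hs
    simp [hs] at hu

lemma exists_path_of_anc {A : Finset V} {p : V → Option V} (hp : IsParentMap A p) (v : V) :
    ∃ r, p r = none ∧ ∃ q : (parentGraph p).Walk v r, q.IsPath ∧
      ∀ w, w ∈ q.support ↔ Anc p v w := by
  induction v using hp.2.induction with
  | _ v ih =>
    rcases h : p v with _ | u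
    · refine ⟨v, h, .nil, .nil, fun w => ?_⟩
      simp only [SimpleGraph.Walk.support_nil, List.mem_singleton]
      constructor
      · rintro rfl
        exact .refl
      · intro hw
        rcases Relation.ReflTransGen.cases_head hw with rfl | ⟨x, hx, -⟩
        · rfl
        · simp [h] at hx
    · obtain ⟨r, hr, q, hq, hq'⟩ := ih u h
      refine ⟨r, hr, .cons ((parentGraph_adj hp.2).2 (.inl h)) q, ?_, fun w => ?_⟩
      · rw [SimpleGraph.Walk.cons_isPath_iff, hq']
        exact ⟨hq, hp.not_anc v u h⟩
      · rw [SimpleGraph.Walk.support_cons, List.mem_cons, hq']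
        constructor
        · rintro (rfl | hw)
          exacts [.refl, hw.head h]
        · intro hw
          rcases Relation.ReflTransGen.cases_head hw with rfl | ⟨x, hx, hx'⟩
          · exact .inl rfl
          · obtain rfl : u = x := by simpa [h] using hx
            exact .inr hx'

/-- Paths in an acyclic graph are unique, so the path from the root to `v` is the reversed chain of
ancestors of `v`. -/
lemma forestRecords_parentGraph [Fintype V] [LinearOrder V] {p : V → Option V}
    (hp : IsParentMap Finset.univ p) :
    forestRecords (parentGraph p) {v | p v = none} = (recordSet Finset.univ p : Set V) := by
  classical
  ext v
  simp only [forestRecords, IsRecord, Set.mem_ofPred_eq, recordSet, Finset.coe_filter,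
    Finset.mem_univ, true_and]
  obtain ⟨r, hr, q, hq, hq'⟩ := exists_path_of_anc hp v
  constructor
  · rintro ⟨s, hs, q', hq1, hq2⟩ w hw
    have hs' := anc_of_reachable hp.2 hr q'.reachable.symm ((hq' r).1 q.end_mem_support)
    obtain rfl : s = r := by
      rcases Relation.ReflTransGen.cases_head hs' with rfl | ⟨u, hu, -⟩
      · rfl
      · simp [hs] at hu
    have := ((isAcyclic_parentGraph hp).subsingleton_path _ _).elim ⟨q'.reverse, hq1.reverse⟩ ⟨q, hq⟩
    have h : q'.reverse = q := congrArg Subtype.val this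
    apply hq2 w
    rw [← hq', ← h] at hw
    simpa using hw
  · intro h
    refine ⟨r, hr, q.reverse, hq.reverse, fun w hw => h w ?_⟩
    rw [← hq']
    simpa using hw

/-- Induction from the roots: `v` is adjacent to its `p`-parent `w`, and if `v` were instead the
`p'`-parent of `w`, then by induction also its `p`-parent, a cycle. -/
lemma parentGraph_injOn [Fintype V] :
    Set.InjOn (fun p : V → Option V => (parentGraph p, {v | p v = none}))
      {p | IsParentMap Finset.univ p} := by
  intro p hp p' hp' h
  simp only [Prod.mk.injEq] at h
  obtain ⟨hG, hS⟩ := h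
  rw [Set.mem_ofPred_eq] at hp hp'
  funext v
  induction v using hp.2.induction with
  | _ v ih =>
    rcases hv : p v with _ | w
    · have : v ∈ {v | p' v = none} := hS ▸ hv
      exact this.symm
    · have : (parentGraph p').Adj v w := hG ▸ (parentGraph_adj hp.2).2 (.inl hv)
      rcases (parentGraph_adj hp'.2).1 this with h | h
      · exact h.symm
      · rw [← ih w hv] at h
        exact (hp.not_anc v w hv (.single h)).elim

/-- `ParentRel G S a b`: in the forest `G` with set of roots `S`, the node `b` is the parent
of `a`. -/
def ParentRel (G : SimpleGraph V) (S : Set V) (a b : V) : Prop :=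
  ∃ r ∈ S, ∃ (h : G.Adj a b) (q : G.Walk b r), (SimpleGraph.Walk.cons h q).IsPath

section

variable {G : SimpleGraph V} {S : Set V}

lemma IsRootedForest.root_unique (hF : IsRootedForest G S) {r s : V} (hr : r ∈ S) (hs : s ∈ S)
    (h : G.Reachable r s) : r = s :=
  (hF.2 (G.connectedComponentMk s)).unique
    ⟨hr, SimpleGraph.ConnectedComponent.eq.2 h⟩ ⟨hs, rfl⟩

lemma IsRootedForest.exists_path (hF : IsRootedForest G S) (v : V) :
    ∃ r ∈ S, ∃ q : G.Walk v r, q.IsPath := by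
  classical
  obtain ⟨r, ⟨hr, h⟩, -⟩ := hF.2 (G.connectedComponentMk v)
  obtain ⟨q⟩ := (SimpleGraph.ConnectedComponent.eq.1 h).symm
  exact ⟨r, hr, q.toPath.1, q.toPath.2⟩

lemma ParentRel.eq_of_isPath (hF : IsRootedForest G S) {a b c r : V} (h : ParentRel G S a b)
    (hr : r ∈ S) (hac : G.Adj a c) (q : G.Walk c r)
    (hq : (SimpleGraph.Walk.cons hac q).IsPath) : b = c := by
  obtain ⟨s, hs, hab, q', hq'⟩ := h
  obtain rfl := hF.root_unique hs hr
    ((SimpleGraph.Walk.cons hab q').reachable.symm.trans (SimpleGraph.Walk.cons hac q).reachable)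
  have h := congrArg Subtype.val ((hF.1.subsingleton_path _ _).elim ⟨_, hq'⟩ ⟨_, hq⟩)
  simp only [SimpleGraph.Walk.cons.injEq] at h
  exact h.1

lemma ParentRel.unique (hF : IsRootedForest G S) {a b c : V} (h : ParentRel G S a b)
    (h' : ParentRel G S a c) : b = c := by
  obtain ⟨s, hs, hac, q, hq⟩ := h'
  exact h.eq_of_isPath hF hs hac q hq

lemma ParentRel.notMem (hF : IsRootedForest G S) {a b : V} (h : ParentRel G S a b) : a ∉ S := by
  obtain ⟨s, hs, hab, q, hq⟩ := h
  intro ha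
  obtain rfl := hF.root_unique ha hs (SimpleGraph.Walk.cons hab q).reachable
  exact ((SimpleGraph.Walk.cons_isPath_iff _ _).1 hq).2 q.end_mem_support

lemma IsRootedForest.exists_parentRel (hF : IsRootedForest G S) {a : V} (ha : a ∉ S) :
    ∃ b, ParentRel G S a b := by
  obtain ⟨r, hr, q, hq⟩ := hF.exists_path a
  cases q with
  | nil => exact (ha hr).elim
  | cons h q => exact ⟨_, r, hr, h, q, hq⟩

/-- If the path from `b` to its root meets `a`, then acyclicity makes `a` its second vertex;
otherwise prefixing `a` gives a path. -/
lemma IsRootedForest.parentRel_or (hF : IsRootedForest G S) {a b : V} (h : G.Adj a b) :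
    ParentRel G S a b ∨ ParentRel G S b a := by
  obtain ⟨r, hr, q, hq⟩ := hF.exists_path b
  by_cases ha : a ∈ q.support
  · right
    cases q with
    | nil =>
      simp only [SimpleGraph.Walk.support_nil, List.mem_singleton] at ha
      exact (h.ne ha).elim
    | @cons _ c _ hbc q =>
      have := hF.1.eq_snd_of_adj_start hq h.symm ha
      simp only [SimpleGraph.Walk.snd_cons] at this
      subst this
      exact ⟨r, hr, hbc, q, hq⟩
  · exact .inl ⟨r, hr, h, q, (SimpleGraph.Walk.cons_isPath_iff _ _).2 ⟨hq, ha⟩⟩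

lemma IsRootedForest.wellFounded_parentRel (hF : IsRootedForest G S) :
    WellFounded fun b a => ParentRel G S a b := by
  -- Induction along the path to the root, whose second vertex is the only parent.
  have key : ∀ v r (q : G.Walk v r), r ∈ S → q.IsPath → Acc (fun b a => ParentRel G S a b) v := by
    intro v r q
    induction q with
    | nil => exact fun hr _ => ⟨_, fun w hw => (hw.notMem hF hr).elim⟩
    | cons h q ih =>
      intro hr hq
      refine ⟨_, fun w hw => ?_⟩
      obtain rfl := hw.eq_of_isPath hF hr h q hq
      exact ih hr ((SimpleGraph.Walk.cons_isPath_iff _ _).1 hq).1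
  refine ⟨fun v => ?_⟩
  obtain ⟨r, hr, q, hq⟩ := hF.exists_path v
  exact key v r q hr hq

lemma IsRootedForest.exists_parentMap [Fintype V] (hF : IsRootedForest G S) :
    ∃ p : V → Option V, IsParentMap Finset.univ p ∧ parentGraph p = G ∧ {v | p v = none} = S := by
  classical
  let p : V → Option V := fun a => if h : ∃ b, ParentRel G S a b then some h.choose else none
  have hp : ∀ a b, p a = some b ↔ ParentRel G S a b := by
    intro a b
    simp only [p]
    split_ifs with h
    · rw [Option.some.injEq]
      exact ⟨fun h' => h' ▸ h.choose_spec, fun h' => h.choose_spec.unique hF h'⟩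
    · simp only [false_iff]
      exact fun h' => h ⟨b, h'⟩
  have hwf : WellFounded fun b a => p a = some b :=
    Subrelation.wf (fun h => (hp _ _).1 h) hF.wellFounded_parentRel
  refine ⟨p, ⟨by simp, hwf⟩, ?_, ?_⟩
  · ext a b
    rw [parentGraph_adj hwf, hp, hp]
    refine ⟨?_, hF.parentRel_or⟩
    rintro (⟨_, _, h, _⟩ | ⟨_, _, h, _⟩)
    exacts [h, h.symm]
  · ext a
    simp only [Set.mem_ofPred_eq, p, dite_eq_right_iff, reduceCtorEq, imp_false]
    refine ⟨fun h => ?_, fun h ⟨b, hb⟩ => hb.notMem hF h⟩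
    by_contra ha
    exact h (hF.exists_parentRel ha)

lemma isRootedForest_singleton {r : V} : IsRootedForest G {r} ↔ G.IsTree := by
  rw [IsRootedForest, SimpleGraph.isTree_iff, and_comm, and_congr_left_iff]
  intro _
  constructor
  · intro h
    have key : ∀ v, G.Reachable r v := by
      intro v
      obtain ⟨s, ⟨rfl, hs⟩, -⟩ := h (G.connectedComponentMk v)
      exact SimpleGraph.ConnectedComponent.eq.1 hs
    exact { preconnected := fun a b => (key a).symm.trans (key b), nonempty := ⟨r⟩ }
  · intro h c
    induction c using SimpleGraph.ConnectedComponent.ind with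
    | _ v =>
      exact ⟨r, ⟨rfl, SimpleGraph.ConnectedComponent.eq.2 (h.preconnected r v)⟩,
        fun s hs => hs.1⟩

end

end ParentGraph

open scoped Classical in
lemma forestRecordNumber_eq_card (n k : ℕ) :
    forestRecordNumber n k =
      {p ∈ parentMaps (Finset.univ : Finset (Fin n)) | (recordSet Finset.univ p).card = k}.card := by
  rw [forestRecordNumber, ← Set.ncard_coe_finset, ←
    (parentGraph_injOn.mono fun p hp => by simp at hp; exact hp.1).ncard_image]
  congr 1
  ext ⟨G, S⟩
  simp only [Set.mem_ofPred_eq, Set.mem_image, Finset.coe_filter, mem_parentMaps, Prod.mk.injEq]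
  constructor
  · rintro ⟨hF, hk⟩
    obtain ⟨p, hp, rfl, rfl⟩ := hF.exists_parentMap
    rw [forestRecords_parentGraph hp, Set.ncard_coe_finset] at hk
    exact ⟨p, ⟨hp, hk⟩, rfl, rfl⟩
  · rintro ⟨p, ⟨hp, hk⟩, rfl, rfl⟩
    rw [forestRecords_parentGraph hp, Set.ncard_coe_finset]
    exact ⟨isRootedForest_parentGraph hp, hk⟩

open scoped Classical in
lemma treeRecordNumber_eq_card (n k : ℕ) :
    treeRecordNumber n k =
      {p ∈ parentMaps (Finset.univ : Finset (Fin n)) |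
        (rootSet Finset.univ p).card = 1 ∧ (recordSet Finset.univ p).card = k}.card := by
  have hinj : Function.Injective
      (fun T : SimpleGraph (Fin n) × Fin n => (T.1, ({T.2} : Set (Fin n)))) := by
    rintro ⟨G, r⟩ ⟨G', r'⟩ h
    simpa using h
  rw [treeRecordNumber, ← Set.ncard_coe_finset, ← Set.ncard_image_of_injective _ hinj,
    ← (parentGraph_injOn.mono fun p hp => by simp at hp; exact hp.1).ncard_image]
  congr 1
  have hrec : ∀ (G : SimpleGraph (Fin n)) r, treeRecords G r = forestRecords G {r} := by
    intro G r
    simp [treeRecords, forestRecords]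
  have hroot : ∀ (p : Fin n → Option (Fin n)) r,
      ({v | p v = none} : Set (Fin n)) = {r} ↔ rootSet Finset.univ p = {r} := by
    intro p r
    rw [← Finset.coe_inj]
    simp [rootSet]
  ext ⟨G, S⟩
  simp only [Set.mem_ofPred_eq, Set.mem_image, Finset.coe_filter, mem_parentMaps, Prod.mk.injEq,
    Prod.exists, hrec]
  constructor
  · rintro ⟨G, r, ⟨hF, hk⟩, rfl, rfl⟩
    rw [← isRootedForest_singleton (r := r)] at hF
    obtain ⟨p, hp, rfl, hr⟩ := hF.exists_parentMap
    rw [← hr, forestRecords_parentGraph hp, Set.ncard_coe_finset] at hk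
    exact ⟨p, ⟨hp, Finset.card_eq_one.2 ⟨r, (hroot p r).1 hr⟩, hk⟩, rfl, hr⟩
  · rintro ⟨p, ⟨hp, h1, hk⟩, rfl, rfl⟩
    obtain ⟨r, hr⟩ := Finset.card_eq_one.1 h1
    have hr := (hroot p r).2 hr
    have hF := isRootedForest_parentGraph hp
    refine ⟨_, r, ⟨by rwa [← isRootedForest_singleton (r := r), ← hr], ?_⟩, rfl, hr.symm⟩
    rw [← hr, forestRecords_parentGraph hp, Set.ncard_coe_finset, hk]

/-! ### Abel's binomial identity -/

section Abel

open Polynomial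

/-- This is the (n+1)-st finite difference of x^n at 1. -/
lemma sum_neg_one_pow_mul_choose_mul_add_one_pow (n : ℕ) :
    ∑ k ∈ Finset.range (n + 2), (-1 : ℚ) ^ (n + 1 - k) * (n + 1).choose k * (k + 1) ^ n = 0 := by
  have h := congrFun (fwdDiff_iter_pow_eq_zero_of_lt (R := ℚ) (Nat.lt_succ_self n)) 1
  rw [fwdDiff_iter_eq_sum_shift] at h
  simpa [add_comm (1 : ℚ)] using h

/-- Differentiating case n + 1 gives n + 1 times case n shifted by `X + 1`, so the two sides differ
by a constant. At X = -(n + 2) the right side vanishes and the left side becomes the preceding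
alternating sum. -/
lemma abel_polynomial_identity (n : ℕ) :
    ∑ k ∈ Finset.range (n + 1), C ((n.choose k : ℚ) * (k + 1) ^ (k - 1)) *
      (X + C ((n - k : ℕ) : ℚ)) ^ (n - k) = (X + C ((n : ℚ) + 1)) ^ n := by
  induction n with
  | zero => simp
  | succ n ih =>
    rw [← sub_eq_zero]
    set P : ℚ[X] := _ - _ with hP
    have hd : derivative P = 0 := by
      have ih' := congrArg (compRingHom (X + 1)) ih
      simp only [map_sum, map_mul, map_pow, coe_compRingHom_apply, C_comp, add_comp, X_comp] at ih'
      rw [hP, derivative_sub, derivative_sum, Finset.sum_range_succ]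
      simp only [derivative_C_mul, derivative_X_add_C_pow, Nat.add_sub_cancel]
      rw [Nat.sub_self, Nat.cast_zero, map_zero, zero_mul, mul_zero, add_zero, sub_eq_zero]
      have : (X + C (((n + 1 : ℕ) : ℚ) + 1)) = (X + 1 + C ((n : ℚ) + 1)) := by
        simp only [map_add, Nat.cast_add, map_one, Nat.cast_one]; ring
      rw [this, ← ih', Finset.mul_sum]
      refine Finset.sum_congr rfl fun k hk => ?_
      have hk : k ≤ n := Nat.lt_succ_iff.1 (Finset.mem_range.1 hk)
      obtain ⟨j, rfl⟩ := Nat.exists_eq_add_of_le hk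
      have h1 : k + j + 1 - k = j + 1 := by omega
      have h2 : k + j - k = j := by omega
      have h3 : ((k + j + 1).choose k : ℚ) * (j + 1) = (k + j + 1) * (k + j).choose k := by
        have := Nat.add_one_mul_choose_eq (k + j) j
        rw [← Nat.choose_symm_of_eq_add (show k + j + 1 = k + (j + 1) by omega),
          ← Nat.choose_symm_of_eq_add (show k + j = k + j by omega)] at this
        exact_mod_cast this.symm
      rw [h1, h2]
      simp only [Nat.add_sub_cancel]
      have h4 : (X + C ((j + 1 : ℕ) : ℚ)) = X + 1 + C (j : ℚ) := by
        simp only [map_add, Nat.cast_add, map_one, Nat.cast_one]; ring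
      rw [h4]
      have h5 := congrArg (fun a : ℚ => C (a * (k + 1) ^ (k - 1))) h3
      simp only [map_mul, map_pow] at h5 ⊢
      push_cast
      simp only [map_add, map_one, C_eq_natCast] at h5 ⊢
      linear_combination (X + 1 + (j : ℚ[X])) ^ j * h5
    obtain ⟨c, hc⟩ := natDegree_eq_zero.1 (derivative_eq_zero.1 hd)
    have h0 : P.eval (-(n + 2 : ℚ)) = 0 := by
      rw [hP, eval_sub, eval_finsetSum, sub_eq_zero]
      simp only [eval_mul, eval_C, eval_pow, eval_add, eval_X]
      rw [show -(n + 2 : ℚ) + (((n + 1 : ℕ) : ℚ) + 1) = 0 by push_cast; ring, zero_pow (by simp)]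
      rw [← sum_neg_one_pow_mul_choose_mul_add_one_pow n]
      refine Finset.sum_congr rfl fun k hk => ?_
      have hk : k ≤ n + 1 := Nat.lt_succ_iff.1 (Finset.mem_range.1 hk)
      rw [Nat.cast_sub hk, show -(n + 2 : ℚ) + (((n + 1 : ℕ) : ℚ) - k) = -1 * (k + 1) by
        push_cast; ring, mul_pow]
      -- For `k = 0` the truncated exponent `k - 1` is harmless because the base is 1.
      rcases k with _ | k
      · simp
      · have : n = k + (n - k) := by omega
        rw [show ((k + 1 : ℕ) + 1 : ℚ) ^ n = ((k + 1 : ℕ) + 1 : ℚ) ^ (k + (n - k)) by rw [← this],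
          pow_add, Nat.add_sub_cancel, Nat.add_sub_add_right]
        ring
    rw [← hc, eval_C] at h0
    rw [← hc, h0, map_zero]

/-- A case of Abel's binomial identity. -/
lemma abel_identity (n : ℕ) :
    ∑ k ∈ Finset.range (n + 1), (n.choose k : ℚ) * (k + 1) ^ (k - 1) *
      ((n - k : ℕ) + 1) ^ (n - k) = (n + 2) ^ n := by
  have h := congrArg (eval 1) (abel_polynomial_identity n)
  simp only [eval_finsetSum, eval_mul, eval_C, eval_pow, eval_add, eval_X] at h
  simp only [add_comm _ (1 : ℚ)] at h ⊢
  rw [h]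
  ring

end Abel

/-! ### The Cayley tree function -/

section Cayley

open PowerSeries

variable (A : Type*) [CommRing A] [Algebra ℚ A]

/-- The exponential generating function `∑ (n + 1) ^ (n - 1) z ^ n / n!` of rooted forests. -/
noncomputable def cayleyForest : A⟦X⟧ :=
  mk fun n => algebraMap ℚ A ((n + 1 : ℚ) ^ (n - 1) / n !)

lemma cayleyTree_eq : cayleyTree A = X * cayleyForest A := by
  ext n
  rcases n with _ | n
  · simp [cayleyTree]
  · rw [coeff_succ_X_mul, cayleyTree, cayleyForest, coeff_mk, coeff_mk, if_neg n.succ_ne_zero]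
    congr 1
    rcases n with _ | n
    · simp
    · have : ((n + 1 : ℕ) ! : ℚ) ≠ 0 := by positivity
      rw [Nat.factorial_succ (n + 1), Nat.add_sub_cancel, Nat.add_sub_cancel]
      push_cast
      field_simp
      ring

@[simp]
lemma constantCoeff_cayleyTree : constantCoeff (cayleyTree A) = 0 := by
  simp [cayleyTree_eq]

@[simp]
lemma constantCoeff_cayleyForest : constantCoeff (cayleyForest A) = 1 := by
  simp [cayleyForest, ← coeff_zero_eq_constantCoeff_apply]

/-- Coefficientwise this is `abel_identity`. It plays the role of F = exp T. -/
lemma derivative_cayleyForest :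
    d⁄dX A (cayleyForest A) = d⁄dX A (cayleyTree A) * cayleyForest A := by
  ext n
  rw [mul_comm, coeff_mul, Finset.Nat.sum_antidiagonal_eq_sum_range_succ_mk]
  simp only [coeff_derivative, cayleyForest, cayleyTree, coeff_mk]
  have hn : (n ! : ℚ) ≠ 0 := by positivity
  have h : ((n + 1 : ℕ) + 1 : ℚ) ^ (n + 1 - 1) / (n + 1)! * (n + 1) =
      ∑ k ∈ Finset.range (n + 1), ((k + 1 : ℚ) ^ (k - 1) / k !) *
        (((n - k + 1 : ℕ) : ℚ) ^ (n - k + 1 - 1) / (n - k + 1)! * ((n - k : ℕ) + 1)) := by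
    have h1 : ((n + 1 : ℕ) + 1 : ℚ) ^ (n + 1 - 1) / (n + 1)! * (n + 1) = (n + 2) ^ n / n ! := by
      rw [Nat.factorial_succ, Nat.add_sub_cancel]
      push_cast
      field_simp
      ring
    rw [h1, ← abel_identity, Finset.sum_div]
    refine Finset.sum_congr rfl fun k hk => ?_
    have hk : k ≤ n := Nat.lt_succ_iff.1 (Finset.mem_range.1 hk)
    have hk1 : (k ! : ℚ) ≠ 0 := by positivity
    have hk2 : ((n - k)! : ℚ) ≠ 0 := by positivity
    rw [Nat.cast_choose ℚ hk, Nat.factorial_succ, Nat.add_sub_cancel]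
    push_cast
    field_simp
  have h' := congrArg (algebraMap ℚ A) h
  simpa using h'

lemma derivative_cayleyTree :
    d⁄dX A (cayleyTree A) * (1 - cayleyTree A) = cayleyForest A := by
  have h : d⁄dX A (cayleyTree A) = cayleyForest A + X * d⁄dX A (cayleyForest A) := by
    conv_lhs => rw [cayleyTree_eq]
    simp [Derivation.leibniz, add_comm, mul_comm]
  rw [derivative_cayleyForest] at h
  rw [cayleyTree_eq] at h ⊢
  linear_combination h

lemma map_cayleyTree {B : Type*} [CommRing B] [Algebra ℚ B] (f : A →+* B) :
    PowerSeries.map f (cayleyTree A) = cayleyTree B := by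
  ext n
  simp only [coeff_map, cayleyTree, coeff_mk]
  split_ifs <;> simp [RingHom.map_rat_algebraMap]

lemma map_cayleyForest {B : Type*} [CommRing B] [Algebra ℚ B] (f : A →+* B) :
    PowerSeries.map f (cayleyForest A) = cayleyForest B := by
  ext n
  simp only [coeff_map, cayleyForest, coeff_mk, RingHom.map_rat_algebraMap]

end Cayley

/-! ### Derivatives of logarithms and powers -/

section Calculus

open PowerSeries

variable {A : Type*} [CommRing A]

lemma hasSubst_sub_one {f : A⟦X⟧} (hf : constantCoeff f = 1) : HasSubst (f - 1) :=
  HasSubst.of_constantCoeff_zero' (by simp [hf])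

lemma subst_one_add_X {g : A⟦X⟧} (hg : HasSubst g) : (1 + X : A⟦X⟧).subst g = 1 + g := by
  rw [← coe_substAlgHom hg, map_add, map_one, coe_substAlgHom hg, subst_X hg]

/-- The chain rule applied to (1 + X) log(1 + X)' = 1, with `f - 1` substituted for `X`. -/
lemma mul_derivative_logOf [Algebra ℚ A] {f : A⟦X⟧} (hf : constantCoeff f = 1) :
    f * d⁄dX A (logOf f) = d⁄dX A f := by
  have hg := hasSubst_sub_one hf
  have h : (1 + X) * d⁄dX A (log A) = 1 := by
    rw [deriv_log]
    ext n
    rcases n with _ | n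
    · simp [add_mul]
    · simp [add_mul, coeff_succ_X_mul, pow_succ, coeff_one]
  have h' := congrArg (fun u : A⟦X⟧ => u.subst (f - 1)) h
  simp only [subst_mul hg, subst_one_add_X hg, add_sub_cancel] at h'
  rw [← coe_substAlgHom hg, map_one, coe_substAlgHom hg] at h'
  rw [logOf_eq, derivative_subst hg, ← mul_assoc, h', one_mul, map_sub, derivative_one, sub_zero]

lemma choose_mul_sub {A : Type*} [CommRing A] [BinomialRing A] [IsAddTorsionFree A]
    (α : A) (n : ℕ) :
    Ring.choose α (n + 1) * (n + 1) = Ring.choose α n * (α - n) := by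
  have h1 := Ring.descPochhammer_eq_factorial_smul_choose α n
  have h2 := Ring.descPochhammer_eq_factorial_smul_choose α (n + 1)
  rw [descPochhammer_succ_right, Polynomial.smeval_mul, h1] at h2
  have h3 : n ! • (Ring.choose α (n + 1) * (n + 1)) = n ! • (Ring.choose α n * (α - n)) := by
    simp only [Polynomial.smeval_sub, Polynomial.smeval_X, pow_one, Polynomial.smeval_natCast,
      pow_zero, nsmul_eq_mul, Nat.factorial_succ, Nat.cast_mul, mul_one, Nat.cast_add,
      Nat.cast_one] at h2 ⊢
    linear_combination -h2
  exact nsmul_right_injective (Nat.factorial_ne_zero n) h3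

/-- The binomial series B satisfies (1 + X)B' = αB by `choose_mul_sub`; substitute `f - 1` and use
the chain rule. -/
lemma mul_derivative_powOf [BinomialRing A] [IsAddTorsionFree A] {f : A⟦X⟧}
    (hf : constantCoeff f = 1) (α : A) :
    f * d⁄dX A (powOf f α) = C α * powOf f α * d⁄dX A f := by
  have hg := hasSubst_sub_one hf
  have h : (1 + X) * d⁄dX A (binomialSeries A α) = C α * binomialSeries A α := by
    ext n
    rcases n with _ | n
    · have : constantCoeff (d⁄dX A (binomialSeries A α)) = α := by
        simp [← coeff_zero_eq_constantCoeff_apply, coeff_derivative]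
      simp [add_mul, this]
    · have := choose_mul_sub α (n + 1)
      simp only [add_mul, one_mul, map_add, coeff_succ_X_mul, coeff_derivative,
        binomialSeries_coeff, smul_eq_mul, mul_one, coeff_C_mul] at this ⊢
      push_cast at this ⊢
      linear_combination this
  have h' := congrArg (fun u : A⟦X⟧ => u.subst (f - 1)) h
  simp only [subst_mul hg, subst_one_add_X hg, add_sub_cancel] at h'
  rw [powOf, derivative_subst hg, ← mul_assoc, h', map_sub, derivative_one, sub_zero, subst_C]
  rfl

lemma constantCoeff_powOf [BinomialRing A] {f : A⟦X⟧} (hf : constantCoeff f = 1) (α : A) :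
    constantCoeff (powOf f α) = 1 := by
  have hg := hasSubst_sub_one hf
  have h : constantCoeff ((binomialSeries A α - 1).subst (f - 1)) = 0 :=
    constantCoeff_subst_eq_zero (by rw [← constantCoeff_eq]; simp [hf]) _ (by simp)
  rw [subst_sub hg, ← coe_substAlgHom hg, map_one, coe_substAlgHom hg, map_sub, map_one,
    sub_eq_zero] at h
  exact h

end Calculus

/-! ### Generating functions of rooted forests -/

section GeneratingFunctions

open PowerSeries

variable {V : Type*} [Fintype V] [LinearOrder V] {R : Type*} [CommRing R]

/-- A power series that satisfies the differential equation corresponding to the removal of the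
largest node is the exponential generating function of `forestSum`. -/
lemma forestSum_eq_factorial_mul_coeff (x : R) (ψ : ℕ → R) (S U F : R⟦X⟧)
    (h0 : constantCoeff S = ψ 0) (hS : d⁄dX R S = C x * ((X * d⁄dX R S + U) * F))
    (hU : ∀ A : Finset V, forestSum x ψ A = A.card ! * coeff A.card S →
      forestSum x (fun r => ψ (r + 1)) A = A.card ! * coeff A.card U)
    (hF : ∀ A : Finset V, forestSum x ψ A = A.card ! * coeff A.card S →
      forestSum 1 (fun _ => (1 : R)) A = A.card ! * coeff A.card F) (A : Finset V) :
    forestSum x ψ A = A.card ! * coeff A.card S := by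
  induction A using Finset.strongInduction with
  | _ A ih =>
  rcases A.eq_empty_or_nonempty with rfl | hA
  · simp [forestSum_empty, h0]
  obtain ⟨m, B, hm, rfl⟩ : ∃ m B, (∀ a ∈ B, a < m) ∧ A = insert m B :=
    ⟨A.max' hA, A.erase (A.max' hA), fun a ha => A.lt_max'_of_mem_erase_max' hA ha,
      (Finset.insert_erase (A.max'_mem hA)).symm⟩
  have hmB : m ∉ B := fun h => lt_irrefl _ (hm m h)
  -- Both `B \ D` and `D` are smaller than the whole set, so the formula for `S` holds on them,
  -- which is what `hU` and `hF` presuppose.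
  have ih' : ∀ D, D ⊆ B → forestSum x ψ D = D.card ! * coeff D.card S := fun D hD =>
    ih D (Finset.ssubset_of_subset_of_ssubset hD (Finset.ssubset_insert hmB))
  let n := B.card
  let g : ℕ → R := fun d => (((n - d : ℕ) : R) * ((n - d)! * coeff (n - d) S) +
    (n - d)! * coeff (n - d) U) * (d ! * coeff d F)
  have h1 : ∀ D ∈ B.powerset, (((B \ D).card * forestSum x ψ (B \ D) +
      forestSum x (fun r => ψ (r + 1)) (B \ D)) * forestSum 1 (fun _ => 1) D) = g D.card := by
    intro D hD
    rw [Finset.mem_powerset] at hD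
    have h := ih' (B \ D) Finset.sdiff_subset
    rw [hU _ h, hF D (ih' D hD), h, Finset.card_sdiff_of_subset hD]
  rw [forestSum_insert x ψ hm, Finset.sum_congr rfl h1, Finset.sum_powerset_apply_card,
    Finset.card_insert_of_notMem hmB]
  have h2 : ((n + 1)! : R) * coeff (n + 1) S = n ! * coeff n (d⁄dX R S) := by
    rw [coeff_derivative, Nat.factorial_succ]
    push_cast
    ring
  -- The operator X d/dX produces the factor that counts the possible parents of `m`.
  have h3 : ∀ i, coeff i (X * d⁄dX R S + U) = i * coeff i S + coeff i U := by
    rintro (_ | i)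
    · simp
    · rw [map_add, coeff_succ_X_mul, coeff_derivative]
      push_cast
      ring
  change x * ∑ d ∈ Finset.range (n + 1), n.choose d • g d = ((n + 1)! : R) * coeff (n + 1) S
  rw [h2, hS, coeff_C_mul, mul_comm (X * d⁄dX R S + U), coeff_mul,
    Finset.Nat.sum_antidiagonal_eq_sum_range_succ_mk, mul_left_comm]
  congr 1
  rw [Finset.mul_sum]
  refine Finset.sum_congr rfl fun d hd => ?_
  have hd : d ≤ n := Nat.lt_succ_iff.1 (Finset.mem_range.1 hd)
  have h4 : (n.choose d * d ! * (n - d)! : R) = n ! := by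
    exact_mod_cast congrArg (Nat.cast (R := R)) (Nat.choose_mul_factorial_mul_factorial hd)
  rw [h3, ← h4, nsmul_eq_mul]
  simp only [g]
  ring

variable [Algebra ℚ R]

/-- The exponential generating function of all rooted forests. -/
lemma forestSum_one_eq (A : Finset V) :
    forestSum 1 (fun _ => (1 : R)) A = A.card ! * coeff A.card (cayleyForest R) := by
  -- Here `S`, `U` and `F` coincide, so the induction hypothesis itself supplies `hU` and `hF`.
  refine forestSum_eq_factorial_mul_coeff 1 _ _ (cayleyForest R) (cayleyForest R) (by simp) ?_
    (fun _ h => h) (fun _ h => h) A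
  have h : d⁄dX R (cayleyTree R) = X * d⁄dX R (cayleyForest R) + cayleyForest R := by
    conv_lhs => rw [cayleyTree_eq]
    simp [Derivation.leibniz]
  rw [← h, map_one, one_mul, ← derivative_cayleyForest]

lemma forestSum_eq_of_derivative (x : R) (S : R⟦X⟧) (h0 : constantCoeff S = 1)
    (hS : (1 - C x * cayleyTree R) * d⁄dX R S = C x * cayleyForest R * S) (A : Finset V) :
    forestSum x (fun _ => 1) A = A.card ! * coeff A.card S := by
  refine forestSum_eq_factorial_mul_coeff x _ S S (cayleyForest R) h0 ?_ (fun _ h => h)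
    (fun A _ => forestSum_one_eq A) A
  rw [cayleyTree_eq] at hS
  linear_combination hS

/-- If `m` becomes a root, the rest must have no root and is therefore empty: this gives `U = 1`. -/
lemma treeSum_eq_of_derivative (x : R) (S : R⟦X⟧) (h0 : constantCoeff S = 0)
    (hS : (1 - C x * cayleyTree R) * d⁄dX R S = C x * cayleyForest R) (A : Finset V) :
    forestSum x (fun r => if r = 1 then 1 else 0) A = A.card ! * coeff A.card S := by
  refine forestSum_eq_factorial_mul_coeff x _ S 1 (cayleyForest R) (by simpa using h0) ?_
    (fun A _ => ?_) (fun A _ => forestSum_one_eq A) A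
  · rw [cayleyTree_eq] at hS
    linear_combination hS
  · simp only [Nat.add_eq_right, forestSum_root_eq_zero, coeff_one, Finset.card_eq_zero]
    split_ifs with h <;> simp [h]

end GeneratingFunctions

/-! ### The record functions -/

section Records

open PowerSeries

lemma sum_card_filter_mul_pow {α R : Type*} [CommSemiring R] [DecidableEq α] (P : Finset α)
    (f : α → ℕ) (N : ℕ) (hf : ∀ a ∈ P, f a < N) (x : R) :
    ∑ k ∈ Finset.range N, (({a ∈ P | f a = k}.card : ℕ) : R) * x ^ k = ∑ a ∈ P, x ^ f a := by
  rw [← Finset.sum_fiberwise_of_maps_to (t := Finset.range N) (g := f)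
    (fun a ha => Finset.mem_range.2 (hf a ha))]
  refine Finset.sum_congr rfl fun k _ => ?_
  rw [Finset.sum_congr rfl (g := fun _ => x ^ k), Finset.sum_const, nsmul_eq_mul]
  intro a ha
  rw [(Finset.mem_filter.1 ha).2]

lemma factorial_mul_coeff_toRatFunc (a : ℕ → ℕ → ℕ) (n : ℕ) :
    (n ! : RatFunc ℝ) * coeff n (toRatFunc (arraySeries a)) =
      ∑ k ∈ Finset.range (n + 1), (a n k : RatFunc ℝ) * RatFunc.X ^ k := by
  have hn : (n ! : ℝ) ≠ 0 := by positivity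
  rw [toRatFunc, coeff_map, arraySeries, coeff_mk, ← map_natCast (algebraMap ℝ[X] (RatFunc ℝ)),
    ← map_mul, Finset.mul_sum, map_sum]
  refine Finset.sum_congr rfl fun k _ => ?_
  rw [← map_natCast (algebraMap ℝ[X] (RatFunc ℝ)) (a n k), ← RatFunc.algebraMap_X, ← map_pow,
    ← map_mul, ← mul_assoc, ← Polynomial.C_eq_natCast, ← Polynomial.C_eq_natCast, ← map_mul,
    mul_div_cancel₀ _ hn]

lemma card_recordSet_lt {n : ℕ} (p : Fin n → Option (Fin n)) :
    (recordSet Finset.univ p).card < n + 1 := by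
  have := Finset.card_le_univ (recordSet Finset.univ p)
  rw [Fintype.card_fin] at this
  omega

lemma coeff_forestRecordSeries_eq (n : ℕ) :
    (n ! : RatFunc ℝ) * coeff n (toRatFunc forestRecordSeries) =
      forestSum RatFunc.X (fun _ => 1) (Finset.univ : Finset (Fin n)) := by
  classical
  simp only [forestRecordSeries, factorial_mul_coeff_toRatFunc, forestRecordNumber_eq_card,
    forestSum, mul_one]
  convert sum_card_filter_mul_pow _ _ _ (fun p _ => card_recordSet_lt p) _

lemma coeff_treeRecordSeries_eq (n : ℕ) :
    (n ! : RatFunc ℝ) * coeff n (toRatFunc treeRecordSeries) =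
      forestSum RatFunc.X (fun r => if r = 1 then 1 else 0) (Finset.univ : Finset (Fin n)) := by
  classical
  simp only [treeRecordSeries, factorial_mul_coeff_toRatFunc, treeRecordNumber_eq_card,
    forestSum, mul_ite, mul_one, mul_zero, ← Finset.sum_filter, ← Finset.filter_filter]
  convert sum_card_filter_mul_pow _ _ _ (fun p _ => card_recordSet_lt p) _

lemma eq_of_factorial_mul_coeff {S S' : (RatFunc ℝ)⟦X⟧}
    (h : ∀ n, (n ! : RatFunc ℝ) * coeff n S = n ! * coeff n S') : S = S' := by
  ext n
  exact mul_left_cancel₀ (Nat.cast_ne_zero.2 n.factorial_ne_zero) (h n)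

lemma toRatFunc_forestRecordSeries_eq {S : (RatFunc ℝ)⟦X⟧} (h0 : constantCoeff S = 1)
    (hS : (1 - C RatFunc.X * cayleyTree (RatFunc ℝ)) * d⁄dX _ S =
      C RatFunc.X * cayleyForest (RatFunc ℝ) * S) : toRatFunc forestRecordSeries = S := by
  refine eq_of_factorial_mul_coeff fun n => ?_
  rw [coeff_forestRecordSeries_eq, forestSum_eq_of_derivative _ S h0 hS, Finset.card_fin]

lemma toRatFunc_treeRecordSeries_eq {S : (RatFunc ℝ)⟦X⟧} (h0 : constantCoeff S = 0)
    (hS : (1 - C RatFunc.X * cayleyTree (RatFunc ℝ)) * d⁄dX _ S =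
      C RatFunc.X * cayleyForest (RatFunc ℝ)) : toRatFunc treeRecordSeries = S := by
  refine eq_of_factorial_mul_coeff fun n => ?_
  rw [coeff_treeRecordSeries_eq, treeSum_eq_of_derivative _ S h0 hS, Finset.card_fin]

lemma constantCoeff_one_sub :
    constantCoeff (1 - C RatFunc.X * cayleyTree (RatFunc ℝ)) = 1 := by simp

lemma derivative_one_sub :
    d⁄dX _ (1 - C RatFunc.X * cayleyTree (RatFunc ℝ)) =
      -(C RatFunc.X * d⁄dX _ (cayleyTree (RatFunc ℝ))) := by
  simp [Derivation.leibniz]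

lemma C_mul_C_sub_one_div :
    (C RatFunc.X : (RatFunc ℝ)⟦X⟧) * C ((RatFunc.X - 1) / RatFunc.X) = C RatFunc.X - 1 := by
  rw [← map_mul, mul_div_cancel₀ _ RatFunc.X_ne_zero, map_sub, map_one]

lemma derivative_treeFormula :
    (1 - C RatFunc.X * cayleyTree (RatFunc ℝ)) * d⁄dX _ (cayleyTree (RatFunc ℝ) -
      C ((RatFunc.X - 1) / RatFunc.X) * logOf (1 - C RatFunc.X * cayleyTree (RatFunc ℝ))) =
      C RatFunc.X * cayleyForest (RatFunc ℝ) := by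
  have h1 := mul_derivative_logOf constantCoeff_one_sub
  rw [derivative_one_sub] at h1
  have h2 := derivative_cayleyTree (RatFunc ℝ)
  have h3 := C_mul_C_sub_one_div
  rw [map_sub, Derivation.leibniz, derivative_C, smul_zero, add_zero, smul_eq_mul]
  linear_combination (-C ((RatFunc.X - 1) / RatFunc.X)) * h1 +
    C RatFunc.X * h2 + d⁄dX _ (cayleyTree (RatFunc ℝ)) * h3

lemma toRatFunc_treeRecordSeries :
    toRatFunc treeRecordSeries = cayleyTree (RatFunc ℝ) -
      C ((RatFunc.X - 1) / RatFunc.X) * logOf (1 - C RatFunc.X * cayleyTree (RatFunc ℝ)) := by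
  refine toRatFunc_treeRecordSeries_eq ?_ derivative_treeFormula
  rw [map_sub, map_mul, constantCoeff_logOf constantCoeff_one_sub]
  simp

lemma toRatFunc_forestRecordSeries :
    toRatFunc forestRecordSeries = cayleyForest (RatFunc ℝ) *
      powOf (1 - C RatFunc.X * cayleyTree (RatFunc ℝ)) (-((RatFunc.X - 1) / RatFunc.X)) := by
  refine toRatFunc_forestRecordSeries_eq ?_ ?_
  · rw [map_mul, constantCoeff_powOf constantCoeff_one_sub]
    simp
  · have h1 := mul_derivative_powOf constantCoeff_one_sub
      (-((RatFunc.X - 1) / RatFunc.X) : RatFunc ℝ)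
    rw [derivative_one_sub, map_neg] at h1
    have h2 := derivative_cayleyTree (RatFunc ℝ)
    have h3 := C_mul_C_sub_one_div
    rw [Derivation.leibniz, smul_eq_mul, smul_eq_mul, derivative_cayleyForest]
    set Q := powOf (1 - C RatFunc.X * cayleyTree (RatFunc ℝ)) (-((RatFunc.X - 1) / RatFunc.X))
    set F := cayleyForest (RatFunc ℝ)
    linear_combination F * h1 + C RatFunc.X * F * Q * h2 +
      F * Q * d⁄dX _ (cayleyTree (RatFunc ℝ)) * h3

/-! #### Extracting the coefficient of a power of `t` -/

lemma toRatFunc_injective : Function.Injective toRatFunc :=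
  map_injective _ (IsFractionRing.injective ℝ[X] (RatFunc ℝ))

lemma derivative_map {A B : Type*} [CommRing A] [CommRing B] (f : A →+* B) (S : A⟦X⟧) :
    d⁄dX B (PowerSeries.map f S) = PowerSeries.map f (d⁄dX A S) := by
  ext n
  simp [coeff_derivative]

/-- The differential equation has no denominators in t, so it descends from ℝ(t) to ℝ[t], where
coefficients of t^k can be compared. -/
lemma derivative_treeRecordSeries :
    d⁄dX _ treeRecordSeries = C Polynomial.X *
      (PowerSeries.map Polynomial.C (cayleyForest ℝ) +
        PowerSeries.map Polynomial.C (cayleyTree ℝ) * d⁄dX _ treeRecordSeries) := by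
  apply toRatFunc_injective
  have h := derivative_treeFormula
  rw [← toRatFunc_treeRecordSeries] at h
  simp only [toRatFunc, map_mul, map_add, ← derivative_map, map_C, RatFunc.algebraMap_X,
    map_cayleyForest, map_cayleyTree] at h ⊢
  linear_combination h

lemma coeffT_add (k : ℕ) (F G : ℝ[X]⟦X⟧) : coeffT k (F + G) = coeffT k F + coeffT k G := by
  ext n
  simp [coeffT]

lemma coeffT_map_C_mul (k : ℕ) (F : ℝ⟦X⟧) (G : ℝ[X]⟦X⟧) :
    coeffT k (PowerSeries.map Polynomial.C F * G) = F * coeffT k G := by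
  ext n
  simp [coeffT, coeff_mul]

lemma coeffT_map_C (k : ℕ) (F : ℝ⟦X⟧) :
    coeffT k (PowerSeries.map Polynomial.C F) = if k = 0 then F else 0 := by
  ext n
  simp only [coeffT, coeff_mk, coeff_map, Polynomial.coeff_C]
  split_ifs <;> simp

lemma coeffT_zero_C_X_mul (G : ℝ[X]⟦X⟧) : coeffT 0 (C Polynomial.X * G) = 0 := by
  ext n
  simp [coeffT]

lemma coeffT_succ_C_X_mul (k : ℕ) (G : ℝ[X]⟦X⟧) :
    coeffT (k + 1) (C Polynomial.X * G) = coeffT k G := by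
  ext n
  simp [coeffT]

lemma derivative_coeffT (k : ℕ) (G : ℝ[X]⟦X⟧) : d⁄dX ℝ (coeffT k G) = coeffT k (d⁄dX _ G) := by
  ext n
  simp only [coeffT, coeff_derivative, coeff_mk]
  rw [show ((n : ℝ[X]) + 1) = Polynomial.C ((n : ℝ) + 1) by simp, Polynomial.coeff_mul_C]

/-- Comparing powers of t, the derivatives start with F at t^1 and each further power of t
multiplies by T. -/
lemma derivative_coeffT_treeRecordSeries (k : ℕ) :
    d⁄dX ℝ (coeffT (k + 1) treeRecordSeries) = cayleyTree ℝ ^ k * cayleyForest ℝ := by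
  have h (k : ℕ) := congrArg (coeffT k) derivative_treeRecordSeries
  simp only [← derivative_coeffT] at h
  induction k with
  | zero =>
    rw [h, coeffT_succ_C_X_mul, coeffT_add, coeffT_map_C_mul, ← derivative_coeffT, h,
      coeffT_zero_C_X_mul, coeffT_map_C]
    simp
  | succ k ih =>
    rw [h, coeffT_succ_C_X_mul, coeffT_add, coeffT_map_C_mul, ← derivative_coeffT, ih,
      coeffT_map_C]
    simp only [Nat.add_eq_zero_iff, one_ne_zero, and_false, if_false]
    ring

lemma coeffT_treeRecordSeries (k : ℕ) :
    coeffT (k + 1) treeRecordSeries =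
      (1 / ((k : ℝ) + 1)) • cayleyTree ℝ ^ (k + 1)
        - (1 / ((k : ℝ) + 1 + 1)) • cayleyTree ℝ ^ (k + 2) := by
  -- Writing F = T'(1 - T) makes both derivatives T^k T'(1 - T); both constant terms vanish.
  apply derivative.ext
  · rw [derivative_coeffT_treeRecordSeries, smul_eq_C_mul, smul_eq_C_mul, map_sub,
      Derivation.leibniz, Derivation.leibniz, derivative_C, derivative_C, smul_zero, smul_zero,
      add_zero, add_zero, smul_eq_mul, smul_eq_mul, derivative_pow, derivative_pow, ← derivative_cayleyTree]
    have h1 : (k : ℝ) + 1 ≠ 0 := by positivity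
    have h2 : (k : ℝ) + 1 + 1 ≠ 0 := by positivity
    have e1 : (C (1 / ((k : ℝ) + 1)) : ℝ⟦X⟧) * ((k + 1 : ℕ) : ℝ⟦X⟧) = 1 := by
      rw [← map_natCast (C (R := ℝ)), ← map_mul]
      push_cast
      rw [one_div_mul_cancel h1, map_one]
    have e2 : (C (1 / ((k : ℝ) + 1 + 1)) : ℝ⟦X⟧) * ((k + 2 : ℕ) : ℝ⟦X⟧) = 1 := by
      rw [← map_natCast (C (R := ℝ)), ← map_mul]
      push_cast
      rw [show (k : ℝ) + 2 = k + 1 + 1 by ring, one_div_mul_cancel h2, map_one]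
    simp only [Nat.add_sub_cancel, show k + 2 - 1 = k + 1 by omega]
    linear_combination (-cayleyTree ℝ ^ k * d⁄dX ℝ (cayleyTree ℝ)) * e1 +
      (cayleyTree ℝ ^ (k + 1) * d⁄dX ℝ (cayleyTree ℝ)) * e2
  · have h := coeff_treeRecordSeries 0 (k + 1)
    rw [treeRecordNumber_eq_zero k.succ_pos] at h
    rw [← coeff_zero_eq_constantCoeff_apply, h]
    simp [smul_eq_C_mul]

end Records

end RecordTrees

theorem mainTheorem3 :
    -- (a) in `ℝ⟦z⟧`
    (∀ k : ℕ, 1 ≤ k →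
      RecordTrees.coeffT k RecordTrees.treeRecordSeries =
        (1 / (k : ℝ)) • RecordTrees.cayleyTree ℝ ^ k
          - (1 / ((k : ℝ) + 1)) • RecordTrees.cayleyTree ℝ ^ (k + 1)) ∧
    -- (b) in `ℝ(t)⟦z⟧`
    (RecordTrees.toRatFunc RecordTrees.treeRecordSeries =
        RecordTrees.cayleyTree (RatFunc ℝ)
          - PowerSeries.C (((RatFunc.X : RatFunc ℝ) - 1) / RatFunc.X) *
            PowerSeries.logOf
              (1 - PowerSeries.C (RatFunc.X : RatFunc ℝ) * RecordTrees.cayleyTree (RatFunc ℝ))) ∧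
    -- (c) in the field `ℝ(t)⸨z⸩` of Laurent series
    (((RecordTrees.toRatFunc RecordTrees.forestRecordSeries : (RatFunc ℝ)⟦X⟧) : (RatFunc ℝ)⸨X⸩) =
        1 / ((PowerSeries.X : (RatFunc ℝ)⟦X⟧) : (RatFunc ℝ)⸨X⸩) *
          (RecordTrees.cayleyTree (RatFunc ℝ) : (RatFunc ℝ)⸨X⸩) *
          (RecordTrees.powOf
              (1 - PowerSeries.C (RatFunc.X : RatFunc ℝ) * RecordTrees.cayleyTree (RatFunc ℝ))
              (-(((RatFunc.X : RatFunc ℝ) - 1) / RatFunc.X)) : (RatFunc ℝ)⸨X⸩)) := by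
  refine ⟨fun k hk => ?_, RecordTrees.toRatFunc_treeRecordSeries, ?_⟩
  · obtain ⟨j, rfl⟩ := Nat.exists_eq_add_of_le' hk
    exact_mod_cast RecordTrees.coeffT_treeRecordSeries j
  · have hX : ((PowerSeries.X : (RatFunc ℝ)⟦X⟧) : (RatFunc ℝ)⸨X⸩) ≠ 0 := by
      simp
    rw [RecordTrees.toRatFunc_forestRecordSeries, RecordTrees.cayleyTree_eq, PowerSeries.coe_mul,
      PowerSeries.coe_mul, ← mul_assoc (1 / _), one_div_mul_cancel hX, one_mul]
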